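/- Let the Fibonacci polynomials be defined by $F_1(x)=1$, $F_2(x)=x$, and $F_n(x)=xF_{n-1}(x)+F_{n-2}(x)$ for $n\ge 3$. For $n\ge 2$, the $n$-th fibotomic polynomial $\Psi_n(x)\in\mathbb{Z}[x]$ is the product of the monic irreducible factors of $F_n(x)$ in $\mathbb{Z}[x]$ which are not factors of $F_k(x)$ for any $1\le k<n$, and the $n$-th homogenized fibotomic polynomial is $\Psi_n(x,y)=y^{\varphi(n)}\Psi_n\big(\frac{x}{y}\big)$, where $\varphi$ is Euler's totient function. Let $n\ge 2$ be an integer. Then the discriminant of $\Psi_n(x,y)$ with respect to $x$ is given by $$\begin{cases} \dfrac{(-1)^{\lfloor\varphi(n)/2\rfloor}(2n)^{\varphi(n)}y^{\varphi(n)(\varphi(n)-1)}}{p^{p^{\alpha-1}+1}}&\text{if } n=p^\alpha\text{ for some prime } p\text{ and some positive integer }\alpha;\\[2ex] \dfrac{(-1)^{\varphi(n)/2}(2n)^{\varphi(n)}y^{\varphi(n)(\varphi(n)-1)}}{\prod_{p\mid n}p^{\varphi(n)/(p-1)}}&\text{otherwise,} \end{cases}$$ where the product in the second case runs over the primes $p$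 dividing $n$, and the discriminant of a monic polynomial of degree $d$ with roots $r_1,\dots,r_d$ is $\prod_{1\le i<j\le d}(r_i-r_j)^2$. -/

import Mathlib

open Polynomial

noncomputable section

/-- The Fibonacci polynomials `F_1 = 1`, `F_2 = x`, `F_n = x F_{n-1} + F_{n-2}`, in `ℤ[x]`, extended
by the usual convention `F_0 = 0`. -/
def fibPoly : ℕ → ℤ[X]
  | 0 => 0
  | 1 => 1
  | (n + 2) => fibPoly (n + 1) * X + fibPoly n

/-- The monic irreducible factors in `ℤ[x]` of the Fibonacci polynomial `F_n` which are not factors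
of `F_k` for any `1 ≤ k < n`. -/
def primitiveFactors (n : ℕ) : Set ℤ[X] :=
  {g | g.Monic ∧ Irreducible g ∧ g ∣ fibPoly n ∧ ∀ k, 1 ≤ k → k < n → ¬ g ∣ fibPoly k}

theorem fibPoly_two : fibPoly 2 = X := by simp [fibPoly]

theorem fibPoly_ne_zero {n : ℕ} (hn : 1 ≤ n) : fibPoly n ≠ 0 := by
  have key : ∀ m : ℕ, 0 < (fibPoly (m + 1)).eval 1 ∧ 0 < (fibPoly (m + 2)).eval 1 := by
    intro m
    induction m with
    | zero => simp [fibPoly]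
    | succ m ih =>
      refine ⟨ih.2, ?_⟩
      have h : fibPoly (m + 3) = fibPoly (m + 2) * X + fibPoly (m + 1) := rfl
      have e : m + 1 + 2 = m + 3 := rfl
      rw [e, h]
      simp only [eval_add, eval_mul, eval_X, mul_one]
      linarith [ih.1, ih.2]
  obtain ⟨m, rfl⟩ : ∃ m, n = m + 1 := ⟨n - 1, by omega⟩
  intro h
  have := (key m).1
  simp [h] at this

/-- The product defining the `n`-th fibotomic polynomial is a finite one. -/
theorem primitiveFactors_finite {n : ℕ} (hn : 1 ≤ n) : (primitiveFactors n).Finite := by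
  classical
  refine (UniqueFactorizationMonoid.normalizedFactors
    (fibPoly n)).toFinset.finite_toSet.subset ?_
  rintro g ⟨hm, hi, hd, -⟩
  have hg : normalize g = g := hm.normalize_eq_self
  rw [Finset.mem_coe, Multiset.mem_toFinset,
    UniqueFactorizationMonoid.mem_normalizedFactors_iff' (fibPoly_ne_zero hn)]
  exact ⟨hi, hg, hd⟩

/-- The `n`-th fibotomic polynomial `Ψ_n(x) ∈ ℤ[x]`, `n ≥ 1`; for `n = 1` the product is empty,
so that `Ψ_1 = 1`. -/
def fibotomic (n : ℕ) : ℤ[X] := ∏ᶠ g ∈ primitiveFactors n, g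

/-- The `n`-th homogenized fibotomic polynomial: `Ψ_1(x, y) = 1` and
`Ψ_n(x, y) = y ^ φ(n) * Ψ_n(x / y)` for `n ≥ 2`, as a polynomial in `x` over `ℚ(y)`; here
`RatFunc.X` is `y` and `Polynomial.X` is `x`. -/
def homFibotomic (n : ℕ) : (RatFunc ℚ)[X] :=
  if n = 1 then 1
  else C (RatFunc.X ^ Nat.totient n) *
    ((fibotomic n).map (Int.castRingHom (RatFunc ℚ))).comp (C (RatFunc.X⁻¹) * X)

end

/-! Substituting x = z - 1/z turns F_m(x)(z + 1/z) into z^m - (-1/z)^m, so F_m vanishes at x exactly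
when (-z^2)^m = 1, provided -z^2 ≠ 1. Hence the roots of Ψ_n are r_k = z_k - 1/z_k with k coprime to
n, where -z_k^2 runs over the primitive n-th roots of unity. Since z_k(r_k - r_j) = (z_k - z_j)(z_k
+ 1/z_j) and j ↦ n - j inverts z_j, differences of the r_k become differences of the -z_k^2. This
gives disc(Ψ_n) Φ_n(1) = 2^φ(n) disc(Φ_n) (`discr_fibotomic_mul_eval_one_cyclotomic`). The
cyclotomic discriminant is known, Φ_n(1) is p for a power of a prime p and 1 otherwise, and
homogenizing multiplies every root by y. -/

/-! ### Discriminants of monic polynomials -/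

theorem Polynomial.eq_prod_X_sub_C_of_eval_eq_zero {K ι : Type*} [Field K] {p : K[X]}
    (hp : p.Monic) {s : Finset ι} {f : ι → K} (hf : Set.InjOn f s)
    (h0 : ∀ k ∈ s, p.eval (f k) = 0) (hd : p.natDegree ≤ s.card) :
    p = ∏ k ∈ s, (X - C (f k)) := by
  have hm : (∏ k ∈ s, (X - C (f k))).Monic := monic_prod_X_sub_C f s
  refine eq_of_monic_of_dvd_of_natDegree_le hm hp ?_ ?_
  · refine Finset.prod_dvd_of_coprime ?_ fun k hk => dvd_iff_isRoot.2 (h0 k hk)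
    intro a ha b hb hab
    exact isCoprime_X_sub_C_of_isUnit_sub (sub_ne_zero.2 fun h => hab (hf ha hb h)).isUnit
  · rwa [natDegree_finsetProd_X_sub_C_eq_card]

theorem Polynomial.Monic.discr_eq_resultant {R : Type*} [CommRing R] {f : R[X]} (hf : f.Monic)
    (hd : 0 < f.natDegree) :
    f.discr = (-1) ^ (f.natDegree * (f.natDegree - 1) / 2) *
      resultant f f.derivative f.natDegree (f.natDegree - 1) := by
  rw [resultant_deriv (natDegree_pos_iff_degree_pos.1 hd), hf.leadingCoeff, mul_one, ← mul_assoc,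
    ← mul_pow, neg_mul_neg, one_mul, one_pow, one_mul]

theorem Polynomial.Monic.discr_map {R S : Type*} [CommRing R] [CommRing S] [Nontrivial S]
    {f : R[X]} (hf : f.Monic) (hd : 0 < f.natDegree) (φ : R →+* S) :
    (f.map φ).discr = φ f.discr := by
  have hd' : (f.map φ).natDegree = f.natDegree := hf.natDegree_map φ
  rw [hf.discr_eq_resultant hd, (hf.map φ).discr_eq_resultant (hd'.symm ▸ hd), hd',
    derivative_map, resultant_map_map]
  simp

/-- Characteristic zero makes the degree drop by exactly one, so the powers of `r` match. -/
theorem Polynomial.derivative_scaleRoots {R : Type*} [CommRing R] [IsDomain R] [CharZero R]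
    (f : R[X]) (r : R) :
    (f.scaleRoots r).derivative = f.derivative.scaleRoots r := by
  ext i
  rw [coeff_derivative, coeff_scaleRoots, coeff_scaleRoots, coeff_derivative,
    natDegree_derivative, Nat.sub_sub, add_comm 1 i]
  ring

theorem Polynomial.Monic.discr_scaleRoots {R : Type*} [CommRing R] [IsDomain R] [CharZero R]
    {f : R[X]} (hf : f.Monic) (hd : 0 < f.natDegree) (r : R) :
    (f.scaleRoots r).discr = r ^ (f.natDegree * (f.natDegree - 1)) * f.discr := by
  have h := resultant_scaleRoots f f.derivative r
  rw [natDegree_scaleRoots, natDegree_scaleRoots, natDegree_derivative] at h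
  rw [hf.discr_eq_resultant hd, ((monic_scaleRoots_iff r).2 hf).discr_eq_resultant
    (by rwa [natDegree_scaleRoots]), natDegree_scaleRoots, derivative_scaleRoots, h]
  ring

/-- The resultant with the derivative is the product of its values at the roots; at a root only the
term omitting that root survives. -/
theorem Polynomial.discr_prod_X_sub_C {K ι : Type*} [Field K] [DecidableEq ι] {s : Finset ι}
    (hs : s.Nonempty) (f : ι → K) :
    (∏ k ∈ s, (X - C (f k))).discr =
      (-1) ^ (s.card * (s.card - 1) / 2) * ∏ k ∈ s, ∏ j ∈ s.erase k, (f k - f j) := by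
  have hm : (∏ k ∈ s, (X - C (f k))).Monic := monic_prod_X_sub_C f s
  have hd : (∏ k ∈ s, (X - C (f k))).natDegree = s.card := natDegree_finsetProd_X_sub_C_eq_card s f
  rw [hm.discr_eq_resultant (hd.symm ▸ hs.card_pos),
    resultant_eq_prod_eval _ _ _ (natDegree_derivative_le _)
      (Splits.prod fun k _ => Splits.X_sub_C (f k)), hm.leadingCoeff, one_pow, one_mul, hd,
    roots_prod _ _ hm.ne_zero]
  simp only [roots_X_sub_C, Multiset.bind_singleton, Multiset.map_map, Function.comp_def]
  congr 1
  refine Finset.prod_congr rfl fun k hk => ?_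
  rw [derivative_prod_finset, eval_finsetSum, Finset.sum_eq_single k]
  · simp [eval_prod]
  · intro j hj hjk
    rw [eval_mul, eval_prod, Finset.prod_eq_zero (Finset.mem_erase.2 ⟨hjk.symm, hk⟩) (by simp),
      zero_mul]
  · exact fun h => absurd hk h

/-! ### Discriminant of the cyclotomic polynomial -/

/-- In an algebraic closure both sides are the signed product of differences of the conjugates of
the generator. This transfers the discriminant of the cyclotomic field to Φ_n. -/
theorem Algebra.discr_powerBasis_eq_discr_minpoly {K L : Type*} [Field K] [Field L] [Algebra K L]
    [Algebra.IsSeparable K L] (pb : PowerBasis K L) :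
    Algebra.discr K pb.basis = (minpoly K pb.gen).discr := by
  let E := AlgebraicClosure L
  have := pb.finite
  let e : Fin pb.dim ≃ (L →ₐ[K] E) := Fintype.equivOfCardEq (by
    rw [Fintype.card_fin, AlgHom.card]
    exact (PowerBasis.finrank pb).symm)
  have hm : (minpoly K pb.gen).Monic := minpoly.monic pb.isIntegral_gen
  have hp : (minpoly K pb.gen).map (algebraMap K E) =
      ∏ i, (X - C (e i pb.gen)) := by
    refine eq_prod_X_sub_C_of_eval_eq_zero (hm.map _) ?_ ?_ ?_
    · exact fun i _ j _ h => e.injective (pb.algHom_ext h)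
    · intro i _
      rw [eval_map_algebraMap, aeval_algHom_apply, minpoly.aeval, map_zero]
    · rw [hm.natDegree_map, pb.natDegree_minpoly, Finset.card_univ, Fintype.card_fin]
  have : NeZero pb.dim := ⟨pb.dim_ne_zero⟩
  apply (algebraMap K E).injective
  rw [← hm.discr_map (by rw [pb.natDegree_minpoly]; exact pb.dim_pos), hp,
    discr_prod_X_sub_C Finset.univ_nonempty, Algebra.discr_powerBasis_eq_prod'' K E pb e,
    Finset.prod_prod_Ioi_mul_eq_prod_prod_off_diag fun i j => e i pb.gen - e j pb.gen,
    PowerBasis.finrank pb, Finset.card_univ, Fintype.card_fin]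
  congr 1
  refine Finset.prod_comm' fun i j => ?_
  simp [eq_comm]

theorem IsCyclotomicExtension.Rat.discr_eq_discr_cyclotomic (n : ℕ) [NeZero n] (K : Type*) [Field K]
    [NumberField K] [IsCyclotomicExtension {n} ℚ K] :
    NumberField.discr K = (cyclotomic n ℤ).discr := by
  have hζ := IsCyclotomicExtension.zeta_spec n ℚ K
  let pB := hζ.integralPowerBasis
  have hpos : 0 < (cyclotomic n ℤ).natDegree := by
    rw [natDegree_cyclotomic]; exact Nat.totient_pos.2 (NeZero.pos n)
  apply (algebraMap ℤ ℚ).injective_int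
  rw [← NumberField.discr_eq_discr _ pB.basis,
    ← Algebra.discr_localizationLocalization ℤ (nonZeroDivisors ℤ) K,
    ← (cyclotomic.monic n ℤ).discr_map hpos, map_cyclotomic]
  have hmin : cyclotomic n ℚ = minpoly ℚ (hζ.powerBasis ℚ).gen := by
    rw [hζ.powerBasis_gen ℚ, cyclotomic_eq_minpoly_rat hζ (NeZero.pos n)]
  rw [hmin, ← Algebra.discr_powerBasis_eq_discr_minpoly]
  have hdim : pB.dim = (hζ.powerBasis ℚ).dim := by
    rw [← PowerBasis.finrank, ← PowerBasis.finrank]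
    exact NumberField.RingOfIntegers.rank K
  rw [← Algebra.discr_reindex _ _ (finCongr hdim)]
  congr 1
  ext i
  rw [Function.comp_apply, Module.Basis.localizationLocalization_apply, PowerBasis.coe_basis,
    (hζ.powerBasis ℚ).basis_eq_pow, hζ.powerBasis_gen ℚ, map_pow, hζ.integralPowerBasis_gen]
  rfl

theorem Polynomial.discr_cyclotomic (n : ℕ) [NeZero n] :
    (cyclotomic n ℤ).discr =
      (-1) ^ (n.totient / 2) * (n ^ n.totient / ∏ p ∈ n.primeFactors, p ^ (n.totient / (p - 1))) := by
  have : IsCyclotomicExtension {n} ℚ (CyclotomicField n ℚ) := by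
    convert! CyclotomicField.isCyclotomicExtension n ℚ
  rw [← IsCyclotomicExtension.Rat.discr_eq_discr_cyclotomic n (CyclotomicField n ℚ)]
  exact IsCyclotomicExtension.Rat.discr n _

/-! ### Roots of the Fibonacci polynomials -/

theorem fibPoly_succ_monic_natDegree (m : ℕ) :
    (fibPoly (m + 1)).Monic ∧ (fibPoly (m + 1)).natDegree = m := by
  induction m using Nat.strong_induction_on with
  | _ m ih =>
    match m with
    | 0 => simp [fibPoly]
    | 1 => rw [fibPoly_two]; exact ⟨monic_X, natDegree_X⟩
    | m + 2 =>
      obtain ⟨h1, d1⟩ := ih (m + 1) (by omega)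
      obtain ⟨h0, d0⟩ := ih m (by omega)
      have hr : fibPoly (m + 2 + 1) = fibPoly (m + 1 + 1) * X + fibPoly (m + 1) := rfl
      have hd : (fibPoly (m + 1 + 1) * X).natDegree = m + 2 := by
        rw [natDegree_mul_X h1.ne_zero, d1]
      have hlt : (fibPoly (m + 1)).natDegree < (fibPoly (m + 1 + 1) * X).natDegree := by omega
      rw [hr]
      exact ⟨(h1.mul monic_X).add_of_left (degree_lt_degree hlt),
        (natDegree_add_eq_left_of_natDegree_lt hlt).trans hd⟩

/-- Binet's formula: z and -1/z are the roots of T^2 = xT + 1 for x = z - 1/z. -/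
theorem aeval_fibPoly_sub_inv {K : Type*} [Field K] {z : K} (hz : z ≠ 0) (m : ℕ) :
    aeval (z - z⁻¹) (fibPoly m) * (z + z⁻¹) = z ^ m - (-z⁻¹) ^ m := by
  induction m using Nat.strong_induction_on with
  | _ m ih =>
    match m with
    | 0 => simp [fibPoly]
    | 1 => simp [fibPoly]
    | m + 2 =>
      have hr : fibPoly (m + 2) = fibPoly (m + 1) * X + fibPoly m := rfl
      rw [hr, map_add, map_mul, aeval_X, add_mul, mul_right_comm, ih (m + 1) (by omega),
        ih m (by omega)]
      have h : z * z⁻¹ = 1 := mul_inv_cancel₀ hz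
      generalize z⁻¹ = u at *
      simp only [pow_succ]
      linear_combination (z ^ m - (-u) ^ m) * (-1) * h

theorem aeval_fibPoly_sub_inv_eq_zero_iff {K : Type*} [Field K] {z : K} (hz : z ≠ 0)
    (hz' : -z ^ 2 ≠ 1) (m : ℕ) :
    aeval (z - z⁻¹) (fibPoly m) = 0 ↔ (-z ^ 2) ^ m = 1 := by
  have h0 : z + z⁻¹ ≠ 0 := by
    intro h
    apply hz'
    have : z * (z + z⁻¹) = 0 := by rw [h, mul_zero]
    rw [mul_add, mul_inv_cancel₀ hz] at this
    linear_combination -this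
  have h1 : (-z⁻¹) ^ m ≠ 0 := pow_ne_zero _ (neg_ne_zero.2 (inv_ne_zero hz))
  rw [← mul_left_inj' h0, aeval_fibPoly_sub_inv hz, zero_mul, sub_eq_zero, ← div_eq_one_iff_eq h1,
    ← div_pow, div_neg, div_inv_eq_mul, ← sq]

/-- The numbers `z_k = i w ^ k`, where `w = exp (π i / n)`; the roots of the `n`-th Fibonacci
polynomial are `z_k - z_k⁻¹` for `0 < k < n`. -/
noncomputable def fibParam (n k : ℕ) : ℂ :=
  Complex.I * Complex.exp (2 * Real.pi * Complex.I / (2 * n : ℕ)) ^ k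

/-- The roots `2 i cos (π k / n)` of the `n`-th Fibonacci polynomial. -/
noncomputable def fibRoot (n k : ℕ) : ℂ := fibParam n k - (fibParam n k)⁻¹

section

variable {n : ℕ}

theorem fibParam_ne_zero (n k : ℕ) : fibParam n k ≠ 0 :=
  mul_ne_zero Complex.I_ne_zero (pow_ne_zero _ (Complex.exp_ne_zero _))

theorem isPrimitiveRoot_exp_two_mul (hn : n ≠ 0) :
    IsPrimitiveRoot (Complex.exp (2 * Real.pi * Complex.I / (2 * n : ℕ))) (2 * n) :=
  Complex.isPrimitiveRoot_exp _ (by omega)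

theorem isPrimitiveRoot_neg_fibParam_one_sq (hn : n ≠ 0) : IsPrimitiveRoot (-fibParam n 1 ^ 2) n := by
  have h := (isPrimitiveRoot_exp_two_mul hn).pow (by omega) (a := 2) (b := n) rfl
  rwa [fibParam, pow_one, mul_pow, Complex.I_sq, neg_one_mul, neg_neg]

theorem neg_fibParam_sq (n k : ℕ) : -fibParam n k ^ 2 = (-fibParam n 1 ^ 2) ^ k := by
  simp only [fibParam, mul_pow, Complex.I_sq, neg_one_mul, neg_neg, pow_one]
  rw [← pow_mul, ← pow_mul, mul_comm k]

theorem fibParam_sub {k : ℕ} (hn : n ≠ 0) (hk : k ≤ n) :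
    fibParam n (n - k) = (fibParam n k)⁻¹ := by
  have hw := isPrimitiveRoot_exp_two_mul hn
  have h := hw.pow (by omega) (a := n) (b := 2) (mul_comm _ _)
  refine eq_inv_of_mul_eq_one_left ?_
  rw [fibParam, fibParam, mul_mul_mul_comm, ← pow_add, Nat.sub_add_cancel hk, h.eq_neg_one_of_two_right,
    Complex.I_mul_I, neg_mul_neg, one_mul]

theorem neg_fibParam_sq_pow_eq_one_iff (hn : n ≠ 0) (k m : ℕ) :
    (-fibParam n k ^ 2) ^ m = 1 ↔ n ∣ k * m := by
  rw [neg_fibParam_sq, ← pow_mul, (isPrimitiveRoot_neg_fibParam_one_sq hn).pow_eq_one_iff_dvd]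

theorem aeval_fibRoot_fibPoly_eq_zero_iff {k : ℕ} (hk : k ∈ Finset.Ioo 0 n) (m : ℕ) :
    aeval (fibRoot n k) (fibPoly m) = 0 ↔ n ∣ k * m := by
  rw [Finset.mem_Ioo] at hk
  rw [fibRoot, aeval_fibPoly_sub_inv_eq_zero_iff (fibParam_ne_zero n k),
    neg_fibParam_sq_pow_eq_one_iff (by omega)]
  have := neg_fibParam_sq_pow_eq_one_iff (n := n) (by omega) k 1
  rw [pow_one, mul_one] at this
  rw [Ne, this]
  exact fun h => absurd (Nat.le_of_dvd hk.1 h) (by omega)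

theorem sub_inv_sub_sub_inv {K : Type*} [Field K] {a b : K} (ha : a ≠ 0) (hb : b ≠ 0) :
    a * ((a - a⁻¹) - (b - b⁻¹)) = (a - b) * (a + b⁻¹) := by
  field_simp
  ring

theorem fibRoot_injOn (n : ℕ) : Set.InjOn (fibRoot n) (Finset.Ioo 0 n) := by
  intro j hj k hk h
  rw [Finset.mem_coe, Finset.mem_Ioo] at hj hk
  have hn : n ≠ 0 := by omega
  have hw := isPrimitiveRoot_exp_two_mul hn
  have h0 := sub_inv_sub_sub_inv (fibParam_ne_zero n j) (fibParam_ne_zero n k)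
  rw [← fibRoot, ← fibRoot, h, sub_self, mul_zero, eq_comm, mul_eq_zero, sub_eq_zero] at h0
  rcases h0 with h0 | h0
  · exact hw.pow_inj (by omega) (by omega) (mul_left_cancel₀ Complex.I_ne_zero h0)
  -- Here z_j z_k = -1, so w^(j+k) = 1 although 0 < j + k < 2n.
  · exfalso
    have h1 : fibParam n j * fibParam n k = -1 := by
      rw [eq_neg_of_add_eq_zero_left h0, neg_mul, inv_mul_cancel₀ (fibParam_ne_zero n k)]
    rw [fibParam, fibParam, mul_mul_mul_comm, Complex.I_mul_I, ← pow_add, neg_one_mul, neg_inj,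
      hw.pow_eq_one_iff_dvd] at h1
    exact absurd (Nat.le_of_dvd (by omega) h1) (by omega)

theorem map_fibPoly_eq_prod (hn : 1 ≤ n) :
    (fibPoly n).map (algebraMap ℤ ℂ) = ∏ k ∈ Finset.Ioo 0 n, (X - C (fibRoot n k)) := by
  obtain ⟨hm, hd⟩ := fibPoly_succ_monic_natDegree (n - 1)
  rw [Nat.sub_add_cancel hn] at hm hd
  refine eq_prod_X_sub_C_of_eval_eq_zero (hm.map _) (fibRoot_injOn n) ?_ ?_
  · intro k hk
    rw [eval_map_algebraMap, aeval_fibRoot_fibPoly_eq_zero_iff hk]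
    exact dvd_mul_left _ _
  · rw [hm.natDegree_map, hd, Nat.card_Ioo, Nat.sub_zero]

/-! ### Roots of the fibotomic polynomials -/

theorem Polynomial.Monic.dvd_of_irreducible_of_common_root {g f : ℤ[X]} (hg : g.Monic)
    (hi : Irreducible g) {a : ℂ} (ha : aeval a g = 0) (hf : aeval a f = 0) : g ∣ f := by
  have hint : IsIntegral ℤ a := ⟨g, hg, ha⟩
  have h := minpoly.isIntegrallyClosed_dvd hint ha
  have := (hi.dvd_iff.1 h).resolve_left (minpoly.irreducible hint).not_isUnit
  exact this.dvd.trans (minpoly.isIntegrallyClosed_dvd hint hf)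

theorem fibotomic_eq_prod (hn : 1 ≤ n) :
    fibotomic n = ∏ g ∈ (primitiveFactors_finite hn).toFinset, g :=
  finprod_mem_eq_finite_toFinset_prod _ _

theorem fibotomic_monic (hn : 1 ≤ n) : (fibotomic n).Monic := by
  rw [fibotomic_eq_prod hn]
  exact monic_prod_of_monic _ _ fun g hg => ((Set.Finite.mem_toFinset _).1 hg).1

theorem fibotomic_dvd_fibPoly (hn : 1 ≤ n) : fibotomic n ∣ fibPoly n := by
  rw [fibotomic_eq_prod hn]
  refine Finset.prod_dvd_of_isRelPrime ?_ fun g hg => ((Set.Finite.mem_toFinset _).1 hg).2.2.1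
  intro g hg h hh hne
  rw [Finset.mem_coe, Set.Finite.mem_toFinset] at hg hh
  refine (hg.2.1.isRelPrime_iff_not_dvd).2 fun hd => hne ?_
  exact eq_of_monic_of_associated hg.1 hh.1 (hg.2.1.associated_of_dvd hh.2.1 hd)

theorem aeval_fibotomic_eq_zero_iff (hn : 1 ≤ n) (a : ℂ) :
    aeval a (fibotomic n) = 0 ↔ ∃ k ∈ Finset.Ioo 0 n, n.Coprime k ∧ fibRoot n k = a := by
  rw [fibotomic_eq_prod hn, map_prod, Finset.prod_eq_zero_iff]
  constructor
  · rintro ⟨g, hg, ha⟩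
    obtain ⟨hm, hi, hd, hnd⟩ := (Set.Finite.mem_toFinset _).1 hg
    have hF : aeval a (fibPoly n) = 0 := aeval_eq_zero_of_dvd_aeval_eq_zero hd ha
    rw [← eval_map_algebraMap, map_fibPoly_eq_prod hn, eval_prod, Finset.prod_eq_zero_iff] at hF
    obtain ⟨k, hk, h0⟩ := hF
    rw [eval_sub, eval_X, eval_C, sub_eq_zero] at h0
    refine ⟨k, hk, ?_, h0.symm⟩
    by_contra hc
    have hk' := Finset.mem_Ioo.1 hk
    have hlt : 1 < n.gcd k := by
      have := Nat.gcd_pos_of_pos_left k hn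
      unfold Nat.Coprime at hc
      omega
    -- With d = gcd(n, k) > 1, n divides k(n/d), so r_k is already a root of F_(n/d).
    refine hnd (n / n.gcd k) (Nat.div_pos (Nat.gcd_le_left _ hn) (by omega))
      (Nat.div_lt_self hn hlt) (hm.dvd_of_irreducible_of_common_root hi ha ?_)
    rw [h0, aeval_fibRoot_fibPoly_eq_zero_iff hk]
    refine ⟨k / n.gcd k, ?_⟩
    rw [← Nat.mul_div_assoc _ (Nat.gcd_dvd_left n k), ← Nat.mul_div_assoc _ (Nat.gcd_dvd_right n k),
      mul_comm]
  · rintro ⟨k, hk, hc, rfl⟩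
    have hF : aeval (fibRoot n k) (fibPoly n) = 0 :=
      (aeval_fibRoot_fibPoly_eq_zero_iff hk n).2 (dvd_mul_left _ _)
    have hm := (fibPoly_succ_monic_natDegree (n - 1)).1
    rw [Nat.sub_add_cancel hn] at hm
    have hint : IsIntegral ℤ (fibRoot n k) := ⟨_, hm, hF⟩
    refine ⟨minpoly ℤ (fibRoot n k), (Set.Finite.mem_toFinset _).2
      ⟨minpoly.monic hint, minpoly.irreducible hint, minpoly.isIntegrallyClosed_dvd hint hF, ?_⟩,
      minpoly.aeval _ _⟩
    intro m hm1 hmn hdvd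
    have h0 := aeval_eq_zero_of_dvd_aeval_eq_zero hdvd (minpoly.aeval _ _)
    rw [aeval_fibRoot_fibPoly_eq_zero_iff hk] at h0
    exact absurd (Nat.le_of_dvd hm1 (hc.dvd_of_dvd_mul_left h0)) (by omega)

/-- The exponents `0 ≤ k < n` coprime to `n`. -/
def coprimesBelow (n : ℕ) : Finset ℕ := {k ∈ Finset.range n | n.Coprime k}

theorem card_coprimesBelow (n : ℕ) : (coprimesBelow n).card = n.totient := rfl

theorem mem_coprimesBelow {k : ℕ} (hn : 2 ≤ n) :
    k ∈ coprimesBelow n ↔ k ∈ Finset.Ioo 0 n ∧ n.Coprime k := by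
  rw [coprimesBelow, Finset.mem_filter, Finset.mem_range, Finset.mem_Ioo]
  refine ⟨fun h => ⟨⟨Nat.pos_of_ne_zero ?_, h.1⟩, h.2⟩, fun h => ⟨h.1.2, h.2⟩⟩
  rintro rfl
  have := (Nat.coprime_zero_right n).1 h.2
  omega

theorem map_fibotomic_eq_prod (hn : 2 ≤ n) :
    (fibotomic n).map (algebraMap ℤ ℂ) = ∏ k ∈ coprimesBelow n, (X - C (fibRoot n k)) := by
  have hn1 : 1 ≤ n := by omega
  have hm := (fibotomic_monic hn1).map (algebraMap ℤ ℂ)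
  have hsub : ∀ k ∈ coprimesBelow n, k ∈ Finset.Ioo 0 n :=
    fun k hk => ((mem_coprimesBelow hn).1 hk).1
  have hnodup : ((fibotomic n).map (algebraMap ℤ ℂ)).roots.Nodup := by
    have hdvd := Polynomial.map_dvd (algebraMap ℤ ℂ) (fibotomic_dvd_fibPoly hn1)
    rw [map_fibPoly_eq_prod hn1] at hdvd
    have hsep := separable_prod_X_sub_C_iff'.2 (fibRoot_injOn n)
    exact nodup_roots (hsep.of_dvd hdvd)
  refine eq_prod_X_sub_C_of_eval_eq_zero hm ((fibRoot_injOn n).mono hsub) ?_ ?_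
  · intro k hk
    obtain ⟨h1, h2⟩ := (mem_coprimesBelow hn).1 hk
    rw [eval_map_algebraMap]
    exact (aeval_fibotomic_eq_zero_iff hn1 _).2 ⟨k, h1, h2, rfl⟩
  -- The roots are simple because Ψ_n divides the separable F_n, so the degree counts distinct
  -- roots.
  · rw [(IsAlgClosed.splits _).natDegree_eq_card_roots, ← Multiset.toFinset_card_of_nodup hnodup]
    refine (Finset.card_le_card (t := (coprimesBelow n).image (fibRoot n)) ?_).trans
      Finset.card_image_le
    intro a ha
    rw [Multiset.mem_toFinset, mem_roots hm.ne_zero, IsRoot, eval_map_algebraMap,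
      aeval_fibotomic_eq_zero_iff hn1] at ha
    obtain ⟨k, hk, hc, rfl⟩ := ha
    exact Finset.mem_image_of_mem _ ((mem_coprimesBelow hn).2 ⟨hk, hc⟩)

end

/-! ### Comparison with the cyclotomic discriminant -/

section

variable {n : ℕ}

theorem sub_mem_coprimesBelow (hn : 2 ≤ n) {k : ℕ} (hk : k ∈ coprimesBelow n) :
    n - k ∈ coprimesBelow n := by
  rw [mem_coprimesBelow hn, Finset.mem_Ioo] at *
  exact ⟨by omega, (Nat.coprime_self_sub_right hk.1.2.le).2 hk.2⟩

theorem prod_coprimesBelow_sub {M : Type*} [CommMonoid M] (hn : 2 ≤ n) (f : ℕ → M) :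
    ∏ k ∈ coprimesBelow n, f (n - k) = ∏ k ∈ coprimesBelow n, f k := by
  have h : ∀ k ∈ coprimesBelow n, n - (n - k) = k := fun k hk => by
    have := Finset.mem_Ioo.1 ((mem_coprimesBelow hn).1 hk).1
    omega
  exact Finset.prod_nbij' (n - ·) (n - ·) (fun k hk => sub_mem_coprimesBelow hn hk)
    (fun k hk => sub_mem_coprimesBelow hn hk) h h fun _ _ => rfl

theorem fibParam_sub_of_mem {k : ℕ} (hk : k ∈ coprimesBelow n) :
    fibParam n (n - k) = (fibParam n k)⁻¹ := by
  have := Finset.mem_range.1 (Finset.mem_filter.1 hk).1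
  exact fibParam_sub (by omega) this.le

theorem prod_fibParam (hn : 2 < n) : ∏ k ∈ coprimesBelow n, fibParam n k = 1 := by
  have hmem : ∀ k ∈ coprimesBelow n, (0 < k ∧ k < n) ∧ n.Coprime k := fun k hk => by
    rw [mem_coprimesBelow hn.le, Finset.mem_Ioo] at hk
    exact hk
  refine Finset.prod_involution (fun k _ => n - k) ?_ ?_
    (fun k hk => sub_mem_coprimesBelow hn.le hk) ?_
  · intro k hk
    rw [fibParam_sub_of_mem hk, mul_inv_cancel₀ (fibParam_ne_zero n k)]
  -- A fixed point k = n/2 divides n and is coprime to it, so k = 1 and n = 2.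
  · intro k hk _ h
    obtain ⟨h1, h2⟩ := hmem k hk
    have h3 : k ∣ n := ⟨2, by omega⟩
    have h4 := Nat.eq_one_of_dvd_coprimes h2 h3 dvd_rfl
    omega
  · intro k hk
    have := hmem k hk
    show n - (n - k) = k
    omega

theorem cyclotomic_eq_prod_fibParam (hn : 2 ≤ n) :
    cyclotomic n ℂ = ∏ k ∈ coprimesBelow n, (X - C (-fibParam n k ^ 2)) := by
  have hζ := isPrimitiveRoot_neg_fibParam_one_sq (n := n) (by omega)
  refine eq_prod_X_sub_C_of_eval_eq_zero (cyclotomic.monic n ℂ) ?_ ?_ ?_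
  · intro j hj k hk h
    dsimp only at h
    rw [neg_fibParam_sq, neg_fibParam_sq n k] at h
    exact hζ.pow_inj (Finset.mem_range.1 (Finset.mem_filter.1 hj).1)
      (Finset.mem_range.1 (Finset.mem_filter.1 hk).1) h
  · intro k hk
    rw [neg_fibParam_sq]
    exact (hζ.pow_of_coprime k (Finset.mem_filter.1 hk).2.symm).isRoot_cyclotomic (by omega)
  · rw [natDegree_cyclotomic, card_coprimesBelow]

/-- Replacing 1/z_j by z_j permutes the full product over j only; restoring the omitted index k
costs z_k + 1/z_k on one side and 2z_k on the other. The minus sign comes from φ(n) - 1 being odd.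
-/
theorem prod_fibRoot_sub (hn : 2 < n) {k : ℕ} (hk : k ∈ coprimesBelow n) :
    fibParam n k ^ (n.totient - 1) * (∏ j ∈ (coprimesBelow n).erase k, (fibRoot n k - fibRoot n j)) *
      (fibParam n k + (fibParam n k)⁻¹) =
    -2 * fibParam n k *
      ∏ j ∈ (coprimesBelow n).erase k, (-fibParam n k ^ 2 - -fibParam n j ^ 2) := by
  have hcard : ((coprimesBelow n).erase k).card = n.totient - 1 := by
    rw [Finset.card_erase_of_mem hk, card_coprimesBelow]
  have hodd : Odd (n.totient - 1) :=
    Nat.Even.sub_odd (Nat.totient_pos.2 (by omega)) (Nat.totient_even hn) odd_one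
  have h1 : fibParam n k ^ (n.totient - 1) *
      (∏ j ∈ (coprimesBelow n).erase k, (fibRoot n k - fibRoot n j)) =
      (∏ j ∈ (coprimesBelow n).erase k, (fibParam n k - fibParam n j)) *
        ∏ j ∈ (coprimesBelow n).erase k, (fibParam n k + (fibParam n j)⁻¹) := by
    rw [← hcard, ← Finset.prod_const, ← Finset.prod_mul_distrib, ← Finset.prod_mul_distrib]
    exact Finset.prod_congr rfl fun j _ =>
      sub_inv_sub_sub_inv (fibParam_ne_zero n k) (fibParam_ne_zero n j)
  have h2 : ∏ j ∈ coprimesBelow n, (fibParam n k + (fibParam n j)⁻¹) =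
      ∏ j ∈ coprimesBelow n, (fibParam n k + fibParam n j) := by
    rw [← prod_coprimesBelow_sub hn.le fun j => fibParam n k + fibParam n j]
    exact Finset.prod_congr rfl fun j hj => by rw [fibParam_sub_of_mem hj]
  rw [← Finset.prod_erase_mul _ _ hk, ← Finset.prod_erase_mul _ _ hk] at h2
  have h3 : ∏ j ∈ (coprimesBelow n).erase k, (-fibParam n k ^ 2 - -fibParam n j ^ 2) =
      -((∏ j ∈ (coprimesBelow n).erase k, (fibParam n k - fibParam n j)) *
        ∏ j ∈ (coprimesBelow n).erase k, (fibParam n k + fibParam n j)) := by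
    rw [← Finset.prod_mul_distrib, ← neg_one_mul (∏ j ∈ (coprimesBelow n).erase k, _),
      ← hodd.neg_one_pow (α := ℂ), ← hcard, ← Finset.prod_const, ← Finset.prod_mul_distrib]
    exact Finset.prod_congr rfl fun j _ => by ring
  rw [h1, mul_assoc, h2, h3]
  ring

theorem natDegree_fibotomic (hn : 2 ≤ n) : (fibotomic n).natDegree = n.totient := by
  rw [← (fibotomic_monic (by omega)).natDegree_map (algebraMap ℤ ℂ), map_fibotomic_eq_prod hn,
    natDegree_finsetProd_X_sub_C_eq_card, card_coprimesBelow]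

theorem discr_fibotomic_mul_eval_one_cyclotomic_of_two_lt (hn : 2 < n) :
    (fibotomic n).discr * (cyclotomic n ℤ).eval 1 = 2 ^ n.totient * (cyclotomic n ℤ).discr := by
  have hpos : 0 < n.totient := Nat.totient_pos.2 (by omega)
  have hne : (coprimesBelow n).Nonempty := Finset.card_pos.1 hpos
  have hm := fibotomic_monic (n := n) (by omega)
  have hdeg : 0 < (fibotomic n).natDegree := by rwa [natDegree_fibotomic hn.le]
  apply (algebraMap ℤ ℂ).injective_int
  have heval : algebraMap ℤ ℂ ((cyclotomic n ℤ).eval 1) =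
      ∏ k ∈ coprimesBelow n, (fibParam n k + (fibParam n k)⁻¹) := by
    rw [← eval_map_apply, map_one, map_cyclotomic, cyclotomic_eq_prod_fibParam hn.le, eval_prod,
      ← one_mul (∏ k ∈ _, (fibParam n k + (fibParam n k)⁻¹))]
    -- Inserting ∏ z_k = 1 uses 1 + z_k^2 = z_k(z_k + 1/z_k).
    nth_rw 2 [← prod_fibParam hn]
    rw [← Finset.prod_mul_distrib]
    refine Finset.prod_congr rfl fun k _ => ?_
    rw [mul_add, mul_inv_cancel₀ (fibParam_ne_zero n k), eval_sub, eval_X, eval_C]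
    ring
  have hprod := Finset.prod_congr rfl fun k hk => prod_fibRoot_sub hn (k := k) hk
  rw [Finset.prod_mul_distrib, Finset.prod_mul_distrib, Finset.prod_mul_distrib,
    Finset.prod_mul_distrib, Finset.prod_pow, prod_fibParam hn, one_pow, one_mul, mul_one,
    Finset.prod_const, card_coprimesBelow, (Nat.totient_even hn).neg_pow] at hprod
  rw [map_mul, map_mul, heval, ← hm.discr_map hdeg, ← (cyclotomic.monic n ℤ).discr_map
    (by rwa [natDegree_cyclotomic]), map_cyclotomic, map_fibotomic_eq_prod hn.le,
    cyclotomic_eq_prod_fibParam hn.le, discr_prod_X_sub_C hne, discr_prod_X_sub_C hne, mul_assoc,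
    hprod, map_pow, map_ofNat]
  ring

theorem discr_fibotomic_mul_eval_one_cyclotomic (hn : 2 ≤ n) :
    (fibotomic n).discr * (cyclotomic n ℤ).eval 1 = 2 ^ n.totient * (cyclotomic n ℤ).discr := by
  rcases hn.eq_or_lt with rfl | hn
  -- For n = 2 the product of the z_k is not 1, but both polynomials are linear and Φ_2(1) = 2.
  · have h1 : (fibotomic 2).degree = 1 :=
      (degree_eq_iff_natDegree_eq_of_pos one_pos).2 (natDegree_fibotomic le_rfl)
    have h2 : (cyclotomic 2 ℤ).degree = 1 := by rw [degree_cyclotomic, Nat.totient_two]; rfl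
    rw [discr_of_degree_eq_one h1, discr_of_degree_eq_one h2]
    norm_num
  · exact discr_fibotomic_mul_eval_one_cyclotomic_of_two_lt hn

end

theorem discr_fibotomic_mul {n : ℕ} (hn : 2 ≤ n) :
    (fibotomic n).discr *
      ((cyclotomic n ℤ).eval 1 * ((∏ p ∈ n.primeFactors, p ^ (n.totient / (p - 1)) : ℕ) : ℤ)) =
      (-1) ^ (n.totient / 2) * (2 * n) ^ n.totient := by
  have : NeZero n := ⟨by omega⟩
  have hdvd : ((∏ p ∈ n.primeFactors, p ^ (n.totient / (p - 1)) : ℕ) : ℤ) ∣ (n : ℤ) ^ n.totient := by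
    exact_mod_cast Nat.prod_primeFactors_pow_totient_ediv_dvd (NeZero.pos n)
  rw [← mul_assoc, discr_fibotomic_mul_eval_one_cyclotomic hn, discr_cyclotomic, mul_assoc,
    mul_assoc, Int.ediv_mul_cancel hdvd, mul_pow]
  ring

/-! ### Homogenization and the final formula -/

theorem homFibotomic_eq_scaleRoots {n : ℕ} (hn : 2 ≤ n) :
    homFibotomic n =
      ((fibotomic n).map (Int.castRingHom (RatFunc ℚ))).scaleRoots RatFunc.X := by
  have hm := fibotomic_monic (n := n) (by omega)
  have hd := natDegree_fibotomic hn
  rw [homFibotomic, if_neg (by omega)]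
  ext1 i
  rw [coeff_C_mul, comp_C_mul_X_coeff, coeff_scaleRoots, hm.natDegree_map, hd]
  rcases le_or_gt i n.totient with h | h
  · rw [pow_sub₀ _ RatFunc.X_ne_zero h, inv_pow]
    ring
  · rw [coeff_map, coeff_eq_zero_of_natDegree_lt (hd.symm ▸ h)]
    simp

theorem discr_homFibotomic {n : ℕ} (hn : 2 ≤ n) :
    (homFibotomic n).discr =
      RatFunc.X ^ (n.totient * (n.totient - 1)) * ((fibotomic n).discr : RatFunc ℚ) := by
  have hm := fibotomic_monic (n := n) (by omega)
  have hpos : 0 < (fibotomic n).natDegree := by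
    rw [natDegree_fibotomic hn]; exact Nat.totient_pos.2 (by omega)
  rw [homFibotomic_eq_scaleRoots hn, (hm.map _).discr_scaleRoots (by rwa [hm.natDegree_map]),
    hm.natDegree_map, natDegree_fibotomic hn, hm.discr_map hpos, eq_intCast]

theorem discr_homFibotomic_eq_div {n D : ℕ} (hn : 2 ≤ n) (hD : D ≠ 0)
    (h : (cyclotomic n ℤ).eval 1 * ((∏ p ∈ n.primeFactors, p ^ (n.totient / (p - 1)) : ℕ) : ℤ) = D) :
    (homFibotomic n).discr =
      (-1) ^ (n.totient / 2) * (2 * (n : RatFunc ℚ)) ^ n.totient *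
        RatFunc.X ^ (n.totient * (n.totient - 1)) / (D : RatFunc ℚ) := by
  have hmul := discr_fibotomic_mul hn
  rw [h] at hmul
  have hmul' := congrArg (Int.cast : ℤ → RatFunc ℚ) hmul
  push_cast at hmul'
  rw [eq_div_iff (Nat.cast_ne_zero.2 hD), discr_homFibotomic hn, ← hmul']
  ring

theorem theorem1p1 (n : ℕ) (hn : 2 ≤ n) :
    (∀ p α : ℕ, p.Prime → 0 < α → n = p ^ α →
      (homFibotomic n).discr =
        (-1) ^ (n.totient / 2) * (2 * (n : RatFunc ℚ)) ^ n.totient *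
            RatFunc.X ^ (n.totient * (n.totient - 1)) /
          (p : RatFunc ℚ) ^ (p ^ (α - 1) + 1)) ∧
    ((¬ ∃ p α : ℕ, p.Prime ∧ 0 < α ∧ n = p ^ α) →
      (homFibotomic n).discr =
        (-1) ^ (n.totient / 2) * (2 * (n : RatFunc ℚ)) ^ n.totient *
            RatFunc.X ^ (n.totient * (n.totient - 1)) /
          ∏ p ∈ n.primeFactors, (p : RatFunc ℚ) ^ (n.totient / (p - 1))) := by
  constructor
  · intro p α hp hα hnp
    have := Fact.mk hp
    rw [discr_homFibotomic_eq_div hn (D := p ^ (p ^ (α - 1) + 1)) (pow_ne_zero _ hp.ne_zero),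
      Nat.cast_pow]
    obtain ⟨k, rfl⟩ : ∃ k, α = k + 1 := ⟨α - 1, by omega⟩
    -- The exponent is φ(p^(k+1))/(p - 1) = p^k, plus one for Φ_n(1) = p.
    rw [hnp, Nat.primeFactors_prime_pow k.succ_ne_zero hp, Finset.prod_singleton,
      Nat.totient_prime_pow_succ hp, Nat.mul_div_cancel _ (by have := hp.two_le; omega),
      eval_one_cyclotomic_prime_pow]
    push_cast
    rw [pow_succ, mul_comm]
  · intro h
    rw [discr_homFibotomic_eq_div hn (D := ∏ p ∈ n.primeFactors, p ^ (n.totient / (p - 1)))]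
    · push_cast
      rfl
    · exact Finset.prod_ne_zero_iff.2 fun p hp =>
        pow_ne_zero _ (Nat.prime_of_mem_primeFactors hp).ne_zero
    · rw [eval_one_cyclotomic_not_prime_pow, one_mul]
      rintro p hp k rfl
      refine h ⟨p, k, hp, Nat.pos_of_ne_zero ?_, rfl⟩
      rintro rfl
      simp at hn
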